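/- For each $n\ge 1$ (the number of states, $n=|\mathcal S|$) let $(x_{ij})_{1\le i,j\le n}$ be i.i.d. exponential random variables with mean $1$. For each row $i$ let $T_i\subseteq\{1,\dots,n\}$ be the deterministic set of columns whose entry in row $i$ is not fixed at zero (all sets may depend on $n$); call row $i$ modified if $T_i\ne\{1,\dots,n\}$. Put $$p_{ij}=\frac{x_{ij}}{\sum_{l\in T_i}x_{il}}\ (j\in T_i),\qquad p_{ij}=0\ (j\notin T_i),\qquad \mathfrak P_1=(p_{ij}),\quad W_1=\mathfrak P_1-I,$$ so that each row of $\mathfrak P_1$ is flat Dirichlet on its free entries, and let $Q_1=(q_{ij})$ with $q_{ij}=n^{-1/2}(x_{ij}-\bar x_i)$ for $j\in T_i$ and $q_{ij}=0$ for $j\notin T_i$, where $\bar x_i=|T_i|^{-1}\sum_{l\in T_i}x_{il}$. Write $\lambda_1\ge\dots\ge\lambda_n$ for eigenvalues and $s_1\ge\dots\ge s_n$ for singular values. For real random variables $X_n(v),Y_n(v)$, with $Y_n(v)\ge 0$, write $X_n(v)\prec Y_n(v)$ uniformly in $v$ if for all $\epsilon,D>0$ there is $N_0$, independent of $v$, such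 that $\mathbb P(X_n(v)>n^{\epsilon}Y_n(v))\le n^{-D}$ for all $n>N_0$ and all $v$. There is an absolute constant $\epsilon_0>0$ such that the following holds. Let $\omega\in(0,1]$ be independent of $n$, and suppose that $|T_i|\ge\omega n$ for all $i$ and $n$ (i.e. at most a $(1-\omega)$-fraction of each row is fixed at zero), and that either - the number of modified rows is bounded independently of $n$ (for example, a single row has exactly $\omega n$ free entries and all others are unmodified), or - for some $\epsilon\in(0,\epsilon_0]$, the number of modified rows is at most $n^{\epsilon}$ for all $n$. Then there is a constant $C>0$, depending only on $\omega$, such that: 1. $\lambda_k(Q_1Q_1^\top)\prec C$, uniformly in $k=1,\dots,n$; 2. for every $n\ge1$, $s_n(W_1)=0$ almost surely; 3. $|s_j(W_1)-1|\prec n^{-1/4}$, uniformly in $j=1,\dots,n-1$; 4. $\operatorname{rank}(W_1)=n-1$ with high probability: for every $D>0$, $\mathbb P(\operatorname{rank}(W_1)=n-1)\ge 1-n^{-D}$ for all sufficiently large $n$. -/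

import Mathlib

open MeasureTheory ProbabilityTheory

noncomputable section

/-- Stochastic domination `X ≺ Y`, uniformly in the parameter `v`: for all `ε, D > 0` there is a
threshold `N₀`, independent of `v`, beyond which
`P (X⁽ⁿ⁾(v) > n ^ ε * Y⁽ⁿ⁾(v)) ≤ n ^ (-D)`. -/
def StochDom {Ω : Type*} [MeasurableSpace Ω] (P : Measure Ω) {V : ℕ → Type}
    (X Y : (n : ℕ) → V n → Ω → ℝ) : Prop :=
  ∀ ε : ℝ, 0 < ε → ∀ D : ℝ, 0 < D → ∃ N₀ : ℕ, ∀ n : ℕ, N₀ < n → ∀ v : V n,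
    P.real {s | (n : ℝ) ^ ε * Y n v s < X n v s} ≤ (n : ℝ) ^ (-D)

/-- The events `E n` hold with high probability. -/
def WithHighProb {Ω : Type*} [MeasurableSpace Ω] (P : Measure Ω) (E : ℕ → Set Ω) : Prop :=
  ∀ D : ℝ, 0 < D → ∃ N₀ : ℕ, ∀ n : ℕ, N₀ ≤ n → 1 - (n : ℝ) ^ (-D) ≤ P.real (E n)

/-- For each size `n`, the entries `x n i j`, `i, j : Fin n`, are i.i.d. exponential random
variables with mean `1`. -/
def IsIIDExpArray {Ω : Type*} [MeasurableSpace Ω] (P : Measure Ω)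
    (x : (n : ℕ) → Fin n → Fin n → Ω → ℝ) : Prop :=
  ∀ n : ℕ, (∀ i j, HasLaw (x n i j) (expMeasure 1) P) ∧
    iIndepFun (fun ij : Fin n × Fin n => x n ij.1 ij.2) P

/-- The rows containing an obstacle, when `T i` is the set of columns `j` at which the entry
`(i, j)` is not fixed at zero. -/
def modifiedRows {n : ℕ} (T : Fin n → Finset (Fin n)) : Finset (Fin n) :=
  {i | T i ≠ Finset.univ}

/-- The random transition matrix with obstacles: row `i` vanishes off `T i` and is the normalisation
of `(x i j)_{j ∈ T i}` on `T i`. For exponential `x` this is a flat Dirichlet vector on `T i`. -/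
def transitionMatrix {n : ℕ} (T : Fin n → Finset (Fin n)) (x : Fin n → Fin n → ℝ) :
    Matrix (Fin n) (Fin n) ℝ :=
  Matrix.of fun i j => if j ∈ T i then x i j / ∑ l ∈ T i, x i l else 0

/-- The sample mean of the free entries of row `i`. -/
def rowMean {n : ℕ} (T : Fin n → Finset (Fin n)) (x : Fin n → Fin n → ℝ) (i : Fin n) : ℝ :=
  (∑ l ∈ T i, x i l) / ((T i).card : ℝ)

/-- The matrix `Q₁`: the free entries of each row, centred by their sample mean and scaled by
`n ^ (-1/2)`; the other entries are zero. -/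
def centredMatrix {n : ℕ} (T : Fin n → Finset (Fin n)) (x : Fin n → Fin n → ℝ) :
    Matrix (Fin n) (Fin n) ℝ :=
  Matrix.of fun i j => if j ∈ T i then (n : ℝ) ^ (-(1 / 2) : ℝ) * (x i j - rowMean T x i) else 0

theorem isHermitian_mul_transpose {n : ℕ} (A : Matrix (Fin n) (Fin n) ℝ) :
    (A * A.transpose).IsHermitian := by
  have h := Matrix.isHermitian_mul_conjTranspose_self A
  rwa [Matrix.conjTranspose_eq_transpose_of_trivial] at h

/-- The eigenvalues of `A * Aᵀ` in decreasing order; the index is zero-based. -/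
def gramEigenvalue {n : ℕ} (A : Matrix (Fin n) (Fin n) ℝ) (k : Fin n) : ℝ :=
  (isHermitian_mul_transpose A).eigenvalues₀ (k.cast (Fintype.card_fin n).symm)

/-- The singular values of an `n × n` matrix in decreasing order; the index is zero-based and only
`j < n` is meaningful. -/
def singularValue {n : ℕ} (A : Matrix (Fin n) (Fin n) ℝ) (j : ℕ) : ℝ :=
  (Matrix.toEuclideanLin A).singularValues j

end

/-!
The transition matrix `P` is compared with the matrix `J` all of whose entries are `1 / n`. Since `1
- J` is the orthogonal projection onto the vectors of coordinate sum zero, if `‖P - J‖ ≤ η` in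
operator norm then `P - 1 = (P - J) - (1 - J)` has norm at most `1 + η` and stretches every vector
of sum zero by at least `1 - η`. Hence all its singular values but the last are within `η` of `1`
(`abs_singularValue_sub_one_le`). The last one vanishes because the rows of `P` sum to `1`
(`singularValue_last_eq_zero`), and the rank is `n - 1` as soon as `η < 1`.

To estimate `P - J`, let `A` be the matrix whose row `i` is the uniform distribution on `T i`. Then
`P - A` is `√n` times `Q₁` with its rows divided by their sums, which are of order `n`. The matrix
`A - J` lives on the modified rows, each of squared norm at most `1 / (ω n)`; so its norm is at most
the square root of the number of modified rows divided by `ω n`. When there are at most `√n` such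
rows this is `O(n ^ (-1/4))`, so that the threshold `ε₀ = 1 / 2` suffices.

It remains to see that `‖Q₁‖` is at most any small power of `n`, with high probability. Stochastic
domination leaves room for a factor `n ^ ε`, so the exponential entries may be truncated at `K = n ^
δ`: the truncation is inactive outside an event of probability at most `n ^ 2 * exp (-K)`. Truncated
and centred entries are sub-Gaussian by Hoeffding's lemma. A union bound over a `1 / 2`-net of the
unit ball, of cardinality at most `5 ^ n`, bounds the norm of the centred free entries by `8 K √n`
(`IsIIDExpArray.norm_freeDeviation_tail`), and the same tail bound controls every row sum, hence the
correction that replaces the common mean by the sample mean of each row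
(`IsIIDExpArray.rowSum_tail`). Everything else is deterministic on the event `IsRegularArray`.
-/

noncomputable section

open scoped Matrix.Norms.L2Operator

/-! ### Nets of the unit ball -/

/-- A `1 / 2`-separated subset of the unit ball of maximal cardinality is a `1 / 2`-net; the volume
bound for separated sets limits its cardinality. -/
theorem exists_half_net {E : Type*} [NormedAddCommGroup E] [NormedSpace ℝ E]
    [FiniteDimensional ℝ E] :
    ∃ N : Finset E, N.card ≤ 5 ^ Module.finrank ℝ E ∧ (∀ u ∈ N, ‖u‖ ≤ 1) ∧
      ∀ v : E, ‖v‖ ≤ 1 → ∃ u ∈ N, ‖v - u‖ ≤ 1 / 2 := by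
  classical
  let S : Set ℕ := {k | ∃ N : Finset E, N.card = k ∧ (∀ u ∈ N, ‖u‖ ≤ 1) ∧
    ∀ u ∈ N, ∀ v ∈ N, u ≠ v → 1 / 2 ≤ ‖u - v‖}
  have hbd : ∀ N : Finset E, (∀ u ∈ N, ‖u‖ ≤ 1) →
      (∀ u ∈ N, ∀ v ∈ N, u ≠ v → 1 / 2 ≤ ‖u - v‖) → N.card ≤ 5 ^ Module.finrank ℝ E := by
    intro N h1 h2
    have hinj : Function.Injective fun u : E => (2 : ℝ) • u := smul_right_injective E two_ne_zero
    rw [← Finset.card_image_of_injective N hinj]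
    apply Besicovitch.card_le_of_separated
    · simp only [Finset.mem_image, forall_exists_index, and_imp]
      rintro _ u hu rfl
      rw [norm_smul, Real.norm_two]
      linarith [h1 u hu]
    · simp only [Finset.mem_image, forall_exists_index, and_imp]
      rintro _ u hu rfl _ v hv rfl huv
      rw [← smul_sub, norm_smul, Real.norm_two]
      linarith [h2 u hu v hv fun h => huv (by rw [h])]
  have hfin : BddAbove S := ⟨5 ^ Module.finrank ℝ E, by
    rintro k ⟨N, rfl, h1, h2⟩
    exact hbd N h1 h2⟩
  have hne : S.Nonempty := ⟨0, ∅, by simp⟩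
  obtain ⟨N, hN, h1, h2⟩ := Nat.sSup_mem hne hfin
  refine ⟨N, hbd N h1 h2, h1, fun v hv => ?_⟩
  by_contra! hcon
  have hvN : v ∉ N := fun h => by have := hcon v h; norm_num at this
  have : (insert v N).card ∈ S := by
    refine ⟨insert v N, rfl, ?_, ?_⟩
    · intro u hu
      rcases Finset.mem_insert.1 hu with rfl | hu
      exacts [hv, h1 u hu]
    · intro u hu w hw huw
      rcases Finset.mem_insert.1 hu with rfl | hu' <;>
        rcases Finset.mem_insert.1 hw with rfl | hw'
      · exact absurd rfl huw
      · exact (hcon w hw').le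
      · rw [norm_sub_rev]; exact (hcon u hu').le
      · exact h2 u hu' w hw' huw
  have := le_csSup hfin this
  rw [Finset.card_insert_of_notMem hvN, hN] at this
  omega

/-- Testing a vector against a `1 / 2`-net of the unit ball recovers half of its norm. -/
theorem norm_le_of_half_net {E : Type*} [NormedAddCommGroup E] [InnerProductSpace ℝ E]
    {N : Finset E} (hN : ∀ v : E, ‖v‖ ≤ 1 → ∃ u ∈ N, ‖v - u‖ ≤ 1 / 2)
    {w : E} {M : ℝ} (hM : ∀ u ∈ N, inner ℝ u w ≤ M) : ‖w‖ ≤ 2 * M := by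
  -- For `w = 0` the inverse is `0` and the normalised vector is `0`; the bounds below still hold.
  have h1 : ‖(‖w‖⁻¹ : ℝ) • w‖ ≤ 1 := by
    rw [norm_smul, norm_inv, norm_norm]
    exact inv_mul_le_one
  obtain ⟨u, hu, hd⟩ := hN _ h1
  have h2 : inner ℝ ((‖w‖⁻¹ : ℝ) • w) w = ‖w‖ := by
    rw [real_inner_smul_left, real_inner_self_eq_norm_sq]
    rcases eq_or_ne ‖w‖ 0 with h | h
    · simp [h]
    · field_simp
  have h3 : inner ℝ ((‖w‖⁻¹ : ℝ) • w - u) w ≤ 1 / 2 * ‖w‖ :=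
    (real_inner_le_norm _ _).trans (mul_le_mul_of_nonneg_right hd (norm_nonneg _))
  rw [inner_sub_left, h2] at h3
  linarith [hM u hu]

/-- The operator norm is controlled by the bilinear form on a `1 / 2`-net. The net is applied first
to the argument and then to the value, each time at the cost of a factor `2`; moving both arguments
of the form at once would need a finer net. -/
theorem opNorm_le_of_half_net {E : Type*} [NormedAddCommGroup E] [InnerProductSpace ℝ E]
    {N : Finset E} (hN : ∀ v : E, ‖v‖ ≤ 1 → ∃ u ∈ N, ‖v - u‖ ≤ 1 / 2)
    (f : E →L[ℝ] E) {M : ℝ} (hM : ∀ u ∈ N, ∀ v ∈ N, inner ℝ u (f v) ≤ M) :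
    ‖f‖ ≤ 4 * M := by
  have hv : ∀ v ∈ N, ‖f v‖ ≤ 2 * M := fun v hv => norm_le_of_half_net hN fun u hu => hM u hu v hv
  obtain ⟨v₀, hv₀, -⟩ := hN 0 (by simp)
  have hM0 : 0 ≤ 2 * M := (norm_nonneg _).trans (hv v₀ hv₀)
  have key : ‖f‖ ≤ 2 * M + 1 / 2 * ‖f‖ := by
    refine f.opNorm_le_of_unit_norm (by positivity) fun x hx => ?_
    obtain ⟨u, hu, hd⟩ := hN x hx.le
    calc ‖f x‖ = ‖f u + f (x - u)‖ := by simp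
      _ ≤ ‖f u‖ + ‖f (x - u)‖ := norm_add_le _ _
      _ ≤ 2 * M + 1 / 2 * ‖f‖ := by
        have := f.le_opNorm (x - u)
        have := mul_le_mul_of_nonneg_left hd (norm_nonneg f)
        linarith [hv u hu]
  linarith

/-! ### Operator norm, eigenvalues and singular values of a matrix -/

section OperatorNorm

variable {n : ℕ}

theorem norm_toEuclideanLin_le (A : Matrix (Fin n) (Fin n) ℝ) (v : EuclideanSpace ℝ (Fin n)) :
    ‖Matrix.toEuclideanLin A v‖ ≤ ‖A‖ * ‖v‖ :=
  A.l2_opNorm_mulVec v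

/-- The operator norm is at most the Frobenius norm. -/
theorem l2_opNorm_le_of_sum_sq_le {A : Matrix (Fin n) (Fin n) ℝ} {F : ℝ} (hF : 0 ≤ F)
    (h : ∑ i, ∑ j, A i j ^ 2 ≤ F ^ 2) : ‖A‖ ≤ F := by
  rw [Matrix.cstar_norm_def]
  refine ContinuousLinearMap.opNorm_le_bound _ hF fun v => ?_
  refine le_of_sq_le_sq ?_ (by positivity)
  rw [mul_pow, EuclideanSpace.real_norm_sq_eq, EuclideanSpace.real_norm_sq_eq]
  calc ∑ i, (Matrix.toEuclideanCLM (n := Fin n) (𝕜 := ℝ) A v) i ^ 2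
      = ∑ i, (∑ j, A i j * v j) ^ 2 := by
        simp [Matrix.ofLp_toEuclideanCLM, Matrix.mulVec, dotProduct]
    _ ≤ ∑ i, (∑ j, A i j ^ 2) * ∑ j, v j ^ 2 :=
        Finset.sum_le_sum fun i _ => Finset.sum_mul_sq_le_sq_mul_sq _ _ _
    _ = (∑ i, ∑ j, A i j ^ 2) * ∑ j, v j ^ 2 := by rw [Finset.sum_mul]
    _ ≤ _ := mul_le_mul_of_nonneg_right h (Finset.sum_nonneg fun _ _ => sq_nonneg _)

theorem gramEigenvalue_le (A : Matrix (Fin n) (Fin n) ℝ) (k : Fin n) :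
    gramEigenvalue A k ≤ ‖A‖ ^ 2 := by
  have hA := isHermitian_mul_transpose A
  obtain ⟨i, hi⟩ : ∃ i, gramEigenvalue A k = hA.eigenvalues i :=
    ⟨(Fintype.equivOfCardEq (Fintype.card_fin _)) (k.cast (Fintype.card_fin n).symm), by
      simp [gramEigenvalue, Matrix.IsHermitian.eigenvalues]⟩
  have h1 := norm_toEuclideanLin_le (A * A.transpose) (hA.eigenvectorBasis i)
  have h2 : Matrix.toEuclideanLin (A * A.transpose) (hA.eigenvectorBasis i) =
      hA.eigenvalues i • hA.eigenvectorBasis i := by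
    ext j
    have := congrFun (hA.mulVec_eigenvectorBasis i) j
    simpa [Matrix.toLpLin_apply] using this
  have h3 : ‖hA.eigenvectorBasis i‖ = 1 := hA.eigenvectorBasis.orthonormal.1 i
  rw [h2, norm_smul, h3, mul_one, mul_one, ← hi] at h1
  have h4 : ‖A * A.transpose‖ ≤ ‖A‖ * ‖A‖ := by
    refine (norm_mul_le _ _).trans_eq ?_
    rw [← Matrix.conjTranspose_eq_transpose_of_trivial, Matrix.l2_opNorm_conjTranspose]
  rw [sq]
  exact (le_abs_self _).trans (h1.trans h4)

/-- The images under `f` of the eigenvectors of `f† f` are orthogonal, and their norms are the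
singular values of `f`. -/
theorem inner_apply_eigenvectorBasis_adjoint_comp_self {E F : Type*} [NormedAddCommGroup E]
    [InnerProductSpace ℝ E] [FiniteDimensional ℝ E] [NormedAddCommGroup F] [InnerProductSpace ℝ F]
    [FiniteDimensional ℝ F] (f : E →ₗ[ℝ] F) {m : ℕ} (hm : Module.finrank ℝ E = m) (i k : Fin m) :
    inner ℝ (f (f.isSymmetric_adjoint_comp_self.eigenvectorBasis hm i))
      (f (f.isSymmetric_adjoint_comp_self.eigenvectorBasis hm k)) =
      if i = k then f.singularValues i ^ 2 else 0 := by
  have h := f.isSymmetric_adjoint_comp_self.apply_eigenvectorBasis hm i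
  rw [← LinearMap.adjoint_inner_left, ← LinearMap.comp_apply, h, real_inner_smul_left,
    orthonormal_iff_ite.1 (f.isSymmetric_adjoint_comp_self.eigenvectorBasis hm).orthonormal,
    f.sq_singularValues_fin hm]
  simp

theorem singularValue_le (A : Matrix (Fin n) (Fin n) ℝ) (j : ℕ) : singularValue A j ≤ ‖A‖ := by
  rcases lt_or_ge j n with hj | hj
  · set f := Matrix.toEuclideanLin A
    have hm : Module.finrank ℝ (EuclideanSpace ℝ (Fin n)) = n := finrank_euclideanSpace_fin
    have h := inner_apply_eigenvectorBasis_adjoint_comp_self f hm ⟨j, hj⟩ ⟨j, hj⟩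
    have h1 := norm_toEuclideanLin_le A
      (f.isSymmetric_adjoint_comp_self.eigenvectorBasis hm ⟨j, hj⟩)
    rw [OrthonormalBasis.norm_eq_one, mul_one] at h1
    rw [real_inner_self_eq_norm_sq, if_pos rfl] at h
    refine le_of_sq_le_sq ?_ (norm_nonneg A)
    rw [singularValue, ← h]
    exact pow_le_pow_left₀ (norm_nonneg _) h1 2
  · rw [singularValue, LinearMap.singularValues_of_finrank_le _ (by simpa using hj)]
    exact norm_nonneg _

/-- If `A` stretches all vectors of a hyperplane by at least `c`, then all singular values but the
last are at least `c`: the span of the right singular vectors of index `j` and `j + 1` meets the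
hyperplane, and on that span `A` stretches by at most the `j`-th singular value. -/
theorem le_singularValue_of_bounded_below {A : Matrix (Fin n) (Fin n) ℝ} {c : ℝ} (hc : 0 ≤ c)
    (φ : EuclideanSpace ℝ (Fin n) →ₗ[ℝ] ℝ)
    (h : ∀ v, φ v = 0 → c * ‖v‖ ≤ ‖Matrix.toEuclideanLin A v‖) {j : ℕ} (hj : j + 1 < n) :
    c ≤ singularValue A j := by
  set f := Matrix.toEuclideanLin A
  have hm : Module.finrank ℝ (EuclideanSpace ℝ (Fin n)) = n := finrank_euclideanSpace_fin
  set b := f.isSymmetric_adjoint_comp_self.eigenvectorBasis hm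
  set i : Fin n := ⟨j, by omega⟩
  set k : Fin n := ⟨j + 1, hj⟩
  have hik : i ≠ k := by simp [i, k, Fin.ext_iff]
  obtain ⟨s, t, hst, hφ⟩ : ∃ s t : ℝ, 0 < s ^ 2 + t ^ 2 ∧ s * φ (b i) + t * φ (b k) = 0 := by
    by_cases h0 : φ (b i) = 0
    · exact ⟨1, 0, by norm_num, by simp [h0]⟩
    · exact ⟨-φ (b k), φ (b i), by positivity, by ring⟩
  have hb := orthonormal_iff_ite.1 b.orthonormal
  have h1 : ‖s • b i + t • b k‖ ^ 2 = s ^ 2 + t ^ 2 := by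
    rw [← real_inner_self_eq_norm_sq]
    simp only [inner_add_left, inner_add_right, real_inner_smul_left, real_inner_smul_right, hb,
      hik, hik.symm, if_true, if_false]
    ring
  have h2 : ‖f (s • b i + t • b k)‖ ^ 2 =
      s ^ 2 * f.singularValues j ^ 2 + t ^ 2 * f.singularValues (j + 1) ^ 2 := by
    rw [← real_inner_self_eq_norm_sq]
    simp only [map_add, map_smul, inner_add_left, inner_add_right, real_inner_smul_left,
      real_inner_smul_right, b, inner_apply_eigenvectorBasis_adjoint_comp_self f hm,
      hik, hik.symm, if_true, if_false]
    simp only [i, k]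
    ring
  have h3 := pow_le_pow_left₀ (by positivity) (h (s • b i + t • b k) (by simpa using hφ)) 2
  rw [mul_pow, h1, h2] at h3
  have h4 : f.singularValues (j + 1) ^ 2 ≤ f.singularValues j ^ 2 :=
    pow_le_pow_left₀ (f.singularValues_nonneg _) (f.singularValues_antitone (Nat.le_succ j)) 2
  refine le_of_sq_le_sq ?_ (f.singularValues_nonneg _)
  refine le_of_mul_le_mul_right ?_ hst
  calc c ^ 2 * (s ^ 2 + t ^ 2) ≤ _ := h3
    _ ≤ s ^ 2 * f.singularValues j ^ 2 + t ^ 2 * f.singularValues j ^ 2 := by gcongr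
    _ = f.singularValues j ^ 2 * (s ^ 2 + t ^ 2) := by ring

end OperatorNorm

/-! ### Sub-Gaussian tails and truncated exponential variables -/

theorem HasSubgaussianMGF.mono {Ω : Type*} [MeasurableSpace Ω] {P : Measure Ω} {X : Ω → ℝ}
    {c d : NNReal} (h : HasSubgaussianMGF X c P) (hcd : c ≤ d) : HasSubgaussianMGF X d P where
  integrable_exp_mul := h.integrable_exp_mul
  mgf_le t := (h.mgf_le t).trans (by gcongr)

/-- Tail bound for a linear combination of independent sub-Gaussian variables with a common
parameter `c`, in terms of an upper bound `B` for the sum of the squared coefficients. -/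
theorem measureReal_weighted_sum_ge_le {Ω ι : Type*} [MeasurableSpace Ω] [Fintype ι]
    {P : Measure Ω} {z : ι → Ω → ℝ} (hind : iIndepFun z P) {c : NNReal}
    (hz : ∀ p, HasSubgaussianMGF (z p) c P) {a : ι → ℝ} {B : ℝ} (hB : ∑ p, a p ^ 2 ≤ B)
    {t : ℝ} (ht : 0 ≤ t) :
    P.real {s | t ≤ ∑ p, a p * z p s} ≤ Real.exp (-t ^ 2 / (2 * (B * c))) := by
  have h0 : 0 ≤ B := (Finset.sum_nonneg fun p _ => sq_nonneg (a p)).trans hB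
  let w : ι → NNReal := fun p => ⟨a p ^ 2, sq_nonneg (a p)⟩
  let b : NNReal := ⟨B, h0⟩
  have h1 := HasSubgaussianMGF.sum_of_iIndepFun
    (hind.comp (fun p y => a p * y) fun p => measurable_const_mul (a p))
    (s := Finset.univ) (c := fun p => w p * c)
    fun p _ => (hz p).const_mul (a p)
  have h2 : ∑ p, w p * c ≤ b * c := by
    rw [← Finset.sum_mul]
    refine mul_le_mul_of_nonneg_right ?_ c.2
    rw [← NNReal.coe_le_coe, NNReal.coe_sum]
    exact hB
  have h3 := (HasSubgaussianMGF.mono h1 h2).measure_ge_le ht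
  have hb : (b : ℝ) = B := rfl
  simpa [hb] using h3

/-- The truncation of `y` to the interval `[0, K]`. -/
def clampTo (K y : ℝ) : ℝ := max 0 (min y K)

theorem measurable_clampTo (K : ℝ) : Measurable (clampTo K) := by
  unfold clampTo
  fun_prop

theorem clampTo_mem_Icc {K : ℝ} (hK : 0 ≤ K) (y : ℝ) : clampTo K y ∈ Set.Icc 0 K :=
  ⟨le_max_left _ _, max_le hK (min_le_right _ _)⟩

theorem clampTo_of_mem_Icc {K y : ℝ} (h0 : 0 ≤ y) (hK : y ≤ K) : clampTo K y = y := by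
  rw [clampTo, min_eq_left hK, max_eq_right h0]

/-- The mean of an exponential variable of mean `1` truncated to `[0, K]`. -/
def truncatedMean (K : ℝ) : ℝ := ∫ y, clampTo K y ∂(expMeasure 1)

theorem expMeasure_real_Iic_zero : (expMeasure 1).real (Set.Iic 0) = 0 := by
  have := isProbabilityMeasure_expMeasure one_pos
  rw [← cdf_eq_real, cdf_expMeasure_eq one_pos]
  simp

theorem expMeasure_real_Ioi {y : ℝ} (hy : 0 ≤ y) :
    (expMeasure 1).real (Set.Ioi y) = Real.exp (-y) := by
  have := isProbabilityMeasure_expMeasure one_pos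
  rw [← Set.compl_Iic, probReal_compl_eq_one_sub measurableSet_Iic, ← cdf_eq_real,
    cdf_expMeasure_eq one_pos, if_pos hy]
  simp

theorem exp_neg_one_le_truncatedMean {K : ℝ} (hK : 1 ≤ K) :
    Real.exp (-1) ≤ truncatedMean K := by
  have := isProbabilityMeasure_expMeasure one_pos
  have hK0 : 0 ≤ K := zero_le_one.trans hK
  rw [← expMeasure_real_Ioi zero_le_one, ← integral_indicator_one measurableSet_Ioi]
  refine integral_mono_of_nonneg (ae_of_all _ fun y => Set.indicator_nonneg (by simp) _)
    (Integrable.of_mem_Icc 0 K (measurable_clampTo K).aemeasurable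
      (ae_of_all _ (clampTo_mem_Icc hK0))) (ae_of_all _ fun y => ?_)
  by_cases hy : y ∈ Set.Ioi (1 : ℝ)
  · rw [Set.indicator_of_mem hy]
    exact (le_min (Set.mem_Ioi.1 hy).le hK).trans (le_max_right _ _)
  · rw [Set.indicator_of_notMem hy]
    exact (clampTo_mem_Icc hK0 y).1

section Array

variable {Ω : Type*} [MeasurableSpace Ω] {P : Measure Ω}
  {x : (n : ℕ) → Fin n → Fin n → Ω → ℝ}

theorem IsIIDExpArray.measureReal_nonpos (hx : IsIIDExpArray P x) (n : ℕ) (i j : Fin n) :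
    P.real {s | x n i j s ≤ 0} = 0 := by
  rw [((hx n).1 i j).measureReal_eq (p := fun y => y ≤ 0) measurableSet_Iic]
  exact expMeasure_real_Iic_zero

theorem IsIIDExpArray.measureReal_gt (hx : IsIIDExpArray P x) (n : ℕ) (i j : Fin n) {K : ℝ}
    (hK : 0 ≤ K) : P.real {s | K < x n i j s} = Real.exp (-K) := by
  rw [((hx n).1 i j).measureReal_eq (p := fun y => K < y) measurableSet_Ioi]
  exact expMeasure_real_Ioi hK

variable [IsProbabilityMeasure P]

theorem IsIIDExpArray.ae_pos (hx : IsIIDExpArray P x) (n : ℕ) :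
    ∀ᵐ s ∂P, ∀ i j, 0 < x n i j s := by
  simp only [ae_all_iff]
  intro i j
  have := hx.measureReal_nonpos n i j
  rw [measureReal_eq_zero_iff] at this
  filter_upwards [compl_mem_ae_iff.2 this] with s hs
  simpa using hs

theorem IsIIDExpArray.hasSubgaussianMGF_clampTo (hx : IsIIDExpArray P x) (n : ℕ) {K : ℝ}
    (hK : 0 ≤ K) (p : Fin n × Fin n) :
    HasSubgaussianMGF (fun s => clampTo K (x n p.1 p.2 s) - truncatedMean K)
      ((‖K - 0‖₊ / 2) ^ 2) P := by
  have hlaw := (hx n).1 p.1 p.2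
  have h := hasSubgaussianMGF_of_mem_Icc (μ := P) (X := fun s => clampTo K (x n p.1 p.2 s))
    ((measurable_clampTo K).comp_aemeasurable hlaw.aemeasurable)
    (ae_of_all _ fun s => clampTo_mem_Icc hK _)
  have hmean := hlaw.integral_comp (f := clampTo K)
    (measurable_clampTo K).aestronglyMeasurable
  simp only [Function.comp_def] at hmean
  rwa [hmean] at h

/-- Hoeffding's inequality for the truncated and centred entries of the array. -/
theorem IsIIDExpArray.tail_le (hx : IsIIDExpArray P x) (n : ℕ) {K : ℝ} (hK : 0 ≤ K)
    {a : Fin n × Fin n → ℝ} {B : ℝ} (hB : ∑ p, a p ^ 2 ≤ B) {t : ℝ} (ht : 0 ≤ t) :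
    P.real {s | t ≤ ∑ p, a p * (clampTo K (x n p.1 p.2 s) - truncatedMean K)} ≤
      Real.exp (-2 * t ^ 2 / (B * K ^ 2)) := by
  have hind := (hx n).2.comp (fun _ y => clampTo K y - truncatedMean K)
    fun _ => (measurable_clampTo K).sub_const _
  refine (measureReal_weighted_sum_ge_le hind (hx.hasSubgaussianMGF_clampTo n hK) hB ht).trans_eq
    ?_
  congr 1
  push_cast
  rw [sub_zero, Real.norm_of_nonneg hK]
  rcases eq_or_ne (B * K ^ 2) 0 with h | h
  · rw [show 2 * (B * (K / 2) ^ 2) = B * K ^ 2 / 2 by ring, h]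
    simp
  · have : B ≠ 0 := left_ne_zero_of_mul h
    have : K ≠ 0 := by rintro rfl; simp at h
    field_simp

end Array

/-- The free entries of the array minus the constant `c`; the entries off `T` are zero. -/
def freeDeviation {n : ℕ} (T : Fin n → Finset (Fin n)) (c : ℝ) (x : Fin n → Fin n → ℝ) :
    Matrix (Fin n) (Fin n) ℝ :=
  Matrix.of fun i j => if j ∈ T i then x i j - c else 0

theorem inner_freeDeviation {n : ℕ} (T : Fin n → Finset (Fin n)) (c : ℝ) (x : Fin n → Fin n → ℝ)
    (u v : EuclideanSpace ℝ (Fin n)) :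
    inner ℝ u (Matrix.toEuclideanCLM (n := Fin n) (𝕜 := ℝ) (freeDeviation T c x) v) =
      ∑ p : Fin n × Fin n, (if p.2 ∈ T p.1 then u p.1 * v p.2 else 0) * (x p.1 p.2 - c) := by
  rw [Fintype.sum_prod_type, PiLp.inner_apply]
  refine Finset.sum_congr rfl fun i _ => ?_
  simp only [Matrix.ofLp_toEuclideanCLM, Matrix.mulVec, dotProduct, freeDeviation, Matrix.of_apply,
    RCLike.inner_apply, conj_trivial, Finset.sum_mul]
  refine Finset.sum_congr rfl fun j _ => ?_
  split_ifs <;> ring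

section Bounds

variable {Ω : Type*} [MeasurableSpace Ω] {P : Measure Ω} [IsProbabilityMeasure P]
  {x : (n : ℕ) → Fin n → Fin n → Ω → ℝ}

/-- Union bound over pairs of points of a `1 / 2`-net, at most `25 ^ n` in number; each pair
contributes at most `exp (-8 n)`. -/
theorem IsIIDExpArray.norm_freeDeviation_tail (hx : IsIIDExpArray P x) {n : ℕ}
    (T : Fin n → Finset (Fin n)) {K : ℝ} (hK : 0 < K) :
    P.real {s | 8 * K * √n < ‖freeDeviation T (truncatedMean K)
      (fun i j => clampTo K (x n i j s))‖} ≤ Real.exp (-n) := by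
  obtain ⟨N, hcard, hN1, hN⟩ := exists_half_net (E := EuclideanSpace ℝ (Fin n))
  rw [finrank_euclideanSpace_fin] at hcard
  set Z : Ω → Matrix (Fin n) (Fin n) ℝ :=
    fun s => freeDeviation T (truncatedMean K) (fun i j => clampTo K (x n i j s))
  let A : EuclideanSpace ℝ (Fin n) × EuclideanSpace ℝ (Fin n) → Set Ω := fun w =>
    {s | 2 * K * √n ≤ inner ℝ w.1 (Matrix.toEuclideanCLM (n := Fin n) (𝕜 := ℝ) (Z s) w.2)}
  have hsub : {s | 8 * K * √n < ‖Z s‖} ⊆ ⋃ w ∈ N ×ˢ N, A w := by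
    intro s hs
    by_contra hcon
    simp only [Set.mem_iUnion, not_exists, A, Finset.mem_product, Set.mem_ofPred_eq, not_le,
      Prod.forall] at hcon
    refine not_lt.2 ?_ (Set.mem_ofPred.1 hs)
    rw [Matrix.cstar_norm_def]
    refine (opNorm_le_of_half_net hN _ fun u hu v hv => (hcon u v ⟨hu, hv⟩).le).trans_eq ?_
    ring
  have hA : ∀ w ∈ N ×ˢ N, P.real (A w) ≤ Real.exp (-8 * n) := by
    rintro ⟨u, v⟩ hw
    rw [Finset.mem_product] at hw
    have hB : ∑ p : Fin n × Fin n, (if p.2 ∈ T p.1 then u p.1 * v p.2 else 0) ^ 2 ≤ 1 := by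
      calc ∑ p : Fin n × Fin n, (if p.2 ∈ T p.1 then u p.1 * v p.2 else 0) ^ 2
          ≤ ∑ p : Fin n × Fin n, u p.1 ^ 2 * v p.2 ^ 2 := by
            refine Finset.sum_le_sum fun p _ => ?_
            split_ifs
            · rw [mul_pow]
            · simp only [ne_eq, OfNat.ofNat_ne_zero, not_false_eq_true, zero_pow]; positivity
        _ = ‖u‖ ^ 2 * ‖v‖ ^ 2 := by
            rw [Fintype.sum_prod_type, EuclideanSpace.real_norm_sq_eq,
              EuclideanSpace.real_norm_sq_eq, Finset.sum_mul_sum]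
        _ ≤ 1 := mul_le_one₀ (pow_le_one₀ (norm_nonneg _) (hN1 u hw.1)) (by positivity)
            (pow_le_one₀ (norm_nonneg _) (hN1 v hw.2))
    have h := hx.tail_le n hK.le hB (t := 2 * K * √n) (by positivity)
    simp only [A, Z, inner_freeDeviation]
    refine h.trans_eq ?_
    congr 1
    rw [mul_pow, Real.sq_sqrt n.cast_nonneg]
    field_simp
    ring
  have hnum : (25 : ℝ) ≤ Real.exp 7 := by
    have h2 : (2 : ℝ) ≤ Real.exp 1 := by linarith [Real.add_one_le_exp (1 : ℝ)]
    calc (25 : ℝ) ≤ 2 ^ 7 := by norm_num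
      _ ≤ Real.exp 1 ^ 7 := by gcongr
      _ = Real.exp 7 := by rw [← Real.exp_nat_mul]; norm_num
  calc P.real {s | 8 * K * √n < ‖Z s‖}
      ≤ P.real (⋃ w ∈ N ×ˢ N, A w) := measureReal_mono hsub (measure_ne_top P _)
    _ ≤ ∑ w ∈ N ×ˢ N, P.real (A w) := measureReal_biUnion_finset_le _ _
    _ ≤ ∑ w ∈ N ×ˢ N, Real.exp (-8 * n) := Finset.sum_le_sum hA
    _ = (N.card : ℝ) ^ 2 * Real.exp (-8 * n) := by
        rw [Finset.sum_const, Finset.card_product, nsmul_eq_mul]; push_cast; ring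
    _ ≤ ((5 : ℝ) ^ n) ^ 2 * Real.exp (-8 * n) := by
        gcongr
        exact_mod_cast hcard
    _ = 25 ^ n * Real.exp (-8 * n) := by rw [← pow_mul, mul_comm n 2, pow_mul]; norm_num
    _ ≤ Real.exp 7 ^ n * Real.exp (-8 * n) := by gcongr
    _ = Real.exp (-n) := by rw [← Real.exp_nat_mul, ← Real.exp_add]; ring_nf

theorem IsIIDExpArray.rowSum_tail (hx : IsIIDExpArray P x) {n : ℕ}
    {T : Fin n → Finset (Fin n)} {i : Fin n} (hT : (T i).Nonempty) {K : ℝ} (hK : 0 < K) :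
    P.real {s | K ^ 2 * √(T i).card <
      |∑ j ∈ T i, (clampTo K (x n i j s) - truncatedMean K)|} ≤ 2 * Real.exp (-(2 * K ^ 2)) := by
  have hpos : (0 : ℝ) < (T i).card := by exact_mod_cast hT.card_pos
  -- The sign `σ = ± 1` covers both tails.
  have key : ∀ σ : ℝ, σ ^ 2 = 1 → P.real {s | K ^ 2 * √(T i).card ≤
      σ * ∑ j ∈ T i, (clampTo K (x n i j s) - truncatedMean K)} ≤
      Real.exp (-(2 * K ^ 2)) := by
    intro σ hσ
    have hB : ∑ p : Fin n × Fin n, (if p.1 = i ∧ p.2 ∈ T i then σ else 0) ^ 2 ≤ (T i).card := by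
      rw [Fintype.sum_prod_type, Finset.sum_eq_single i]
      · simp [ite_pow, hσ]
      · intro k _ hk; simp [hk]
      · simp
    have h := hx.tail_le n hK.le hB (t := K ^ 2 * √(T i).card) (by positivity)
    have hsum : ∀ s, ∑ p : Fin n × Fin n, (if p.1 = i ∧ p.2 ∈ T i then σ else 0) *
        (clampTo K (x n p.1 p.2 s) - truncatedMean K) =
        σ * ∑ j ∈ T i, (clampTo K (x n i j s) - truncatedMean K) := by
      intro s
      rw [Fintype.sum_prod_type, Finset.sum_eq_single i, Finset.mul_sum]
      · simp
      · intro k _ hk; simp [hk]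
      · simp
    simp only [hsum] at h
    refine h.trans_eq ?_
    congr 1
    rw [mul_pow, Real.sq_sqrt hpos.le]
    field_simp
  refine (measureReal_mono (s₂ := {s | K ^ 2 * √(T i).card ≤
      1 * ∑ j ∈ T i, (clampTo K (x n i j s) - truncatedMean K)} ∪
      {s | K ^ 2 * √(T i).card ≤
      (-1) * ∑ j ∈ T i, (clampTo K (x n i j s) - truncatedMean K)})
      ?_ (measure_ne_top P _)).trans ?_
  · intro s hs
    rcases lt_abs.1 (Set.mem_ofPred.1 hs) with h | h
    · left; simpa using h.le
    · right; simpa using h.le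
  · refine (measureReal_union_le _ _).trans ?_
    linarith [key 1 (by norm_num), key (-1) (by norm_num)]

/-- The deterministic properties of a typical array: the free entries centred at `c` have operator
norm of order `K √n`, and their row sums are of the order of the square root of the number of terms,
up to a factor `K ^ 2`. -/
structure IsRegularArray {n : ℕ} (T : Fin n → Finset (Fin n)) (K c : ℝ)
    (x : Fin n → Fin n → ℝ) : Prop where
  norm_le : ‖freeDeviation T c x‖ ≤ 8 * K * √n
  abs_rowSum_le : ∀ i, |∑ j ∈ T i, (x i j - c)| ≤ K ^ 2 * √(T i).card

theorem IsIIDExpArray.measureReal_not_isRegularArray_le (hx : IsIIDExpArray P x) {n : ℕ}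
    {T : Fin n → Finset (Fin n)} (hT : ∀ i, (T i).Nonempty) {K : ℝ} (hK : 0 < K) :
    P.real {s | ¬ IsRegularArray T K (truncatedMean K) (fun i j => x n i j s)} ≤
      n ^ 2 * Real.exp (-K) + Real.exp (-n) + n * (2 * Real.exp (-(2 * K ^ 2))) := by
  set B₀ : Set Ω := ⋃ p : Fin n × Fin n, {s | x n p.1 p.2 s ≤ 0} ∪ {s | K < x n p.1 p.2 s}
  set B₁ : Set Ω := {s | 8 * K * √n < ‖freeDeviation T (truncatedMean K)
      (fun i j => clampTo K (x n i j s))‖}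
  set B₂ : Set Ω := ⋃ i : Fin n, {s | K ^ 2 * √(T i).card <
      |∑ j ∈ T i, (clampTo K (x n i j s) - truncatedMean K)|}
  have hsub : {s | ¬ IsRegularArray T K (truncatedMean K) (fun i j => x n i j s)} ⊆
      B₀ ∪ B₁ ∪ B₂ := by
    intro s hs
    by_contra hcon
    simp only [B₀, B₁, B₂, Set.mem_union, Set.mem_iUnion, Set.mem_ofPred_eq, not_or, not_exists,
      not_le, not_lt, Prod.forall] at hcon
    obtain ⟨⟨h0, h1⟩, h2⟩ := hcon
    -- Off the first bad event all entries lie in `[0, K]`, where the truncation is the identity.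
    have htr : ∀ i j, clampTo K (x n i j s) = x n i j s := fun i j =>
      clampTo_of_mem_Icc (h0 i j).1.le (h0 i j).2
    simp only [htr] at h1 h2
    exact hs ⟨h1, h2⟩
  have h0 : P.real B₀ ≤ n ^ 2 * Real.exp (-K) := by
    refine (measureReal_iUnion_fintype_le _).trans ?_
    calc _ ≤ ∑ _p : Fin n × Fin n, Real.exp (-K) := by
          refine Finset.sum_le_sum fun p _ => (measureReal_union_le _ _).trans_eq ?_
          rw [hx.measureReal_nonpos, hx.measureReal_gt n _ _ hK.le, zero_add]
      _ = _ := by simp [sq]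
  have h2 : P.real B₂ ≤ n * (2 * Real.exp (-(2 * K ^ 2))) := by
    refine (measureReal_iUnion_fintype_le _).trans ?_
    calc _ ≤ ∑ _i : Fin n, 2 * Real.exp (-(2 * K ^ 2)) :=
          Finset.sum_le_sum fun i _ => hx.rowSum_tail (hT i) hK
      _ = _ := by simp
  refine (measureReal_mono hsub (measure_ne_top P _)).trans ((measureReal_union_le _ _).trans ?_)
  refine add_le_add ((measureReal_union_le _ _).trans (add_le_add h0 ?_)) h2
  exact hx.norm_freeDeviation_tail T hK

end Bounds

/-! ### Comparison with the uniform matrix on a regular array -/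

section Deterministic

variable {n : ℕ} {T : Fin n → Finset (Fin n)} {x : Fin n → Fin n → ℝ} {K c : ℝ}

/-- The difference between the sample mean of each row and the constant `c`, placed at the free
entries. -/
def meanDeviation (T : Fin n → Finset (Fin n)) (c : ℝ) (x : Fin n → Fin n → ℝ) :
    Matrix (Fin n) (Fin n) ℝ :=
  Matrix.of fun i j => if j ∈ T i then (∑ l ∈ T i, (x i l - c)) / ((T i).card : ℝ) else 0

theorem rowMean_sub (hT : ∀ i, (T i).Nonempty) (c : ℝ) (i : Fin n) :
    (∑ l ∈ T i, (x i l - c)) / ((T i).card : ℝ) = rowMean T x i - c := by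
  have : ((T i).card : ℝ) ≠ 0 := by exact_mod_cast (hT i).card_pos.ne'
  rw [rowMean, Finset.sum_sub_distrib, Finset.sum_const, nsmul_eq_mul]
  field_simp

/-- Centring at the sample mean does not depend on the constant `c` subtracted beforehand, so `c`
need not be the mean of the entries. -/
theorem centredMatrix_eq (hT : ∀ i, (T i).Nonempty) (c : ℝ) :
    centredMatrix T x = (√n)⁻¹ • (freeDeviation T c x - meanDeviation T c x) := by
  have hpow : (n : ℝ) ^ (-(1 / 2) : ℝ) = (√n)⁻¹ := by
    rw [Real.rpow_neg n.cast_nonneg, Real.sqrt_eq_rpow]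
  ext i j
  simp only [centredMatrix, freeDeviation, meanDeviation, rowMean_sub hT, Matrix.of_apply,
    Matrix.smul_apply, Matrix.sub_apply, smul_eq_mul, hpow]
  split_ifs <;> ring

theorem IsRegularArray.norm_meanDeviation_le (hT : ∀ i, (T i).Nonempty)
    (h : IsRegularArray T K c x) : ‖meanDeviation T c x‖ ≤ K ^ 2 * √n := by
  refine l2_opNorm_le_of_sum_sq_le (by positivity) ?_
  calc ∑ i, ∑ j, meanDeviation T c x i j ^ 2
      = ∑ i, (∑ l ∈ T i, (x i l - c)) ^ 2 / ((T i).card : ℝ) := by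
        refine Finset.sum_congr rfl fun i _ => ?_
        have : ((T i).card : ℝ) ≠ 0 := by exact_mod_cast (hT i).card_pos.ne'
        simp only [meanDeviation, Matrix.of_apply, ite_pow, ne_eq, OfNat.ofNat_ne_zero,
          not_false_eq_true, zero_pow, Finset.sum_ite_mem, Finset.univ_inter, Finset.sum_const,
          nsmul_eq_mul]
        field_simp
    _ ≤ ∑ _i : Fin n, (K ^ 2) ^ 2 := by
        refine Finset.sum_le_sum fun i _ => ?_
        have : (0 : ℝ) < (T i).card := by exact_mod_cast (hT i).card_pos
        rw [div_le_iff₀ this, ← sq_abs]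
        refine (pow_le_pow_left₀ (abs_nonneg _) (h.abs_rowSum_le i) 2).trans_eq ?_
        rw [mul_pow, Real.sq_sqrt this.le]
    _ = (K ^ 2 * √n) ^ 2 := by
        rw [mul_pow, Real.sq_sqrt n.cast_nonneg]
        simp [mul_comm]

theorem IsRegularArray.norm_centredMatrix_le (hn : n ≠ 0) (hT : ∀ i, (T i).Nonempty)
    (hK : 1 ≤ K) (h : IsRegularArray T K c x) : ‖centredMatrix T x‖ ≤ 9 * K ^ 2 := by
  have hn' : 0 < √(n : ℝ) := by positivity
  rw [centredMatrix_eq hT c, norm_smul, norm_inv, Real.norm_of_nonneg hn'.le,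
    inv_mul_le_iff₀ hn']
  refine (norm_sub_le _ _).trans ?_
  have h1 := h.norm_le
  have h2 := h.norm_meanDeviation_le hT
  have h3 : K * √n ≤ K ^ 2 * √n := by gcongr; nlinarith
  linarith

/-- Row sums are at least half of their typical value `c * (T i).card` once the fluctuation bound is
at most half of that value. -/
theorem IsRegularArray.le_sum (h : IsRegularArray T K c x)
    (hc : ∀ i, K ^ 2 * √(T i).card ≤ c / 2 * (T i).card) (i : Fin n) :
    c / 2 * (T i).card ≤ ∑ l ∈ T i, x i l := by
  have h1 := (abs_le.1 (h.abs_rowSum_le i)).1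
  rw [Finset.sum_sub_distrib, Finset.sum_const, nsmul_eq_mul] at h1
  linarith [hc i]

/-- The matrix whose row `i` is the uniform distribution on `T i`. -/
def meanMatrix (T : Fin n → Finset (Fin n)) : Matrix (Fin n) (Fin n) ℝ :=
  Matrix.of fun i j => if j ∈ T i then ((T i).card : ℝ)⁻¹ else 0

/-- The matrix with all entries `1 / n`, the orthogonal projection onto the constant vectors. -/
def uniformMatrix (n : ℕ) : Matrix (Fin n) (Fin n) ℝ :=
  Matrix.of fun _ _ => (n : ℝ)⁻¹

theorem transitionMatrix_sub_meanMatrix (hn : n ≠ 0) (hT : ∀ i, (T i).Nonempty)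
    (hS : ∀ i, ∑ l ∈ T i, x i l ≠ 0) :
    transitionMatrix T x - meanMatrix T =
      √n • (Matrix.diagonal (fun i => (∑ l ∈ T i, x i l)⁻¹) * centredMatrix T x) := by
  have hpow : (n : ℝ) ^ (-(1 / 2) : ℝ) = (√n)⁻¹ := by
    rw [Real.rpow_neg n.cast_nonneg, Real.sqrt_eq_rpow]
  have hn' : √(n : ℝ) ≠ 0 := by positivity
  ext i j
  have h1 := hS i
  have h2 : ((T i).card : ℝ) ≠ 0 := by exact_mod_cast (hT i).card_pos.ne'
  simp only [transitionMatrix, meanMatrix, centredMatrix, rowMean, Matrix.of_apply,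
    Matrix.smul_apply, Matrix.sub_apply, smul_eq_mul, hpow, Matrix.diagonal_mul]
  split_ifs
  · field_simp
  · simp

theorem norm_transitionMatrix_sub_meanMatrix_le (hn : n ≠ 0) (hT : ∀ i, (T i).Nonempty) {a : ℝ}
    (ha : 0 < a) (hS : ∀ i, a ≤ ∑ l ∈ T i, x i l) :
    ‖transitionMatrix T x - meanMatrix T‖ ≤ √n * (a⁻¹ * ‖centredMatrix T x‖) := by
  rw [transitionMatrix_sub_meanMatrix hn hT fun i => (ha.trans_le (hS i)).ne', norm_smul,
    Real.norm_of_nonneg (Real.sqrt_nonneg _)]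
  gcongr
  refine (norm_mul_le _ _).trans ?_
  gcongr
  rw [Matrix.l2_opNorm_diagonal, pi_norm_le_iff_of_nonneg (by positivity)]
  intro i
  rw [norm_inv, Real.norm_of_nonneg (ha.trans_le (hS i)).le]
  exact inv_anti₀ ha (hS i)

/-- Only the modified rows of the difference are nonzero, and a row with `m` free entries has
squared norm `1 / m - 1 / n`. -/
theorem norm_meanMatrix_sub_uniformMatrix_le {ω : ℝ} (hω : 0 < ω) (hn : n ≠ 0)
    (hT : ∀ i, ω * n ≤ (T i).card) :
    ‖meanMatrix T - uniformMatrix n‖ ≤ √((modifiedRows T).card / (ω * n)) := by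
  have hn' : (0 : ℝ) < n := by positivity
  refine l2_opNorm_le_of_sum_sq_le (Real.sqrt_nonneg _) ?_
  rw [Real.sq_sqrt (by positivity)]
  calc ∑ i, ∑ j, (meanMatrix T - uniformMatrix n) i j ^ 2
      = ∑ i, (((T i).card : ℝ)⁻¹ - (n : ℝ)⁻¹) := by
        refine Finset.sum_congr rfl fun i _ => ?_
        have hpos : 0 < ((T i).card : ℝ) := (by positivity : 0 < ω * n).trans_le (hT i)
        have : ∀ j, (meanMatrix T - uniformMatrix n) i j ^ 2 =
            (if j ∈ T i then ((T i).card : ℝ)⁻¹ ^ 2 - 2 * ((T i).card : ℝ)⁻¹ * (n : ℝ)⁻¹ else 0) +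
              (n : ℝ)⁻¹ ^ 2 := by
          intro j
          simp only [meanMatrix, uniformMatrix, Matrix.sub_apply, Matrix.of_apply]
          split_ifs <;> ring
        simp only [this, Finset.sum_add_distrib, Finset.sum_ite_mem, Finset.univ_inter,
          Finset.sum_const, nsmul_eq_mul, Finset.card_univ, Fintype.card_fin]
        field_simp
        ring
    _ ≤ ∑ i, if i ∈ modifiedRows T then (ω * n)⁻¹ else 0 := by
        refine Finset.sum_le_sum fun i _ => ?_
        split_ifs with hi
        · have : ((T i).card : ℝ)⁻¹ ≤ (ω * n)⁻¹ := inv_anti₀ (by positivity) (hT i)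
          have : 0 < (n : ℝ)⁻¹ := by positivity
          linarith
        · have : T i = Finset.univ := by simpa [modifiedRows] using hi
          simp [this]
    _ = (modifiedRows T).card / (ω * n) := by
        simp [Finset.sum_ite_mem, div_eq_mul_inv]

theorem norm_one_sub_uniformMatrix_apply_le (v : EuclideanSpace ℝ (Fin n)) :
    ‖Matrix.toEuclideanLin (1 - uniformMatrix n) v‖ ≤ ‖v‖ := by
  rcases eq_or_ne n 0 with rfl | hn
  · rw [Subsingleton.elim (Matrix.toEuclideanLin (1 - uniformMatrix 0) v) v]
  refine le_of_sq_le_sq ?_ (norm_nonneg _)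
  rw [EuclideanSpace.real_norm_sq_eq, EuclideanSpace.real_norm_sq_eq]
  have h : ∀ i, Matrix.toEuclideanLin (1 - uniformMatrix n) v i = v i - (n : ℝ)⁻¹ * ∑ j, v j := by
    intro i
    simp [Matrix.toLpLin_apply, uniformMatrix, Matrix.mulVec, dotProduct,
      Finset.mul_sum]
  have hn' : (n : ℝ) ≠ 0 := by positivity
  simp only [h, sub_sq, Finset.sum_add_distrib, Finset.sum_sub_distrib, Finset.sum_const,
    nsmul_eq_mul, Finset.card_univ, Fintype.card_fin, ← Finset.sum_mul, ← Finset.mul_sum]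
  have : (n : ℝ) * ((n : ℝ)⁻¹ * ∑ j, v j) ^ 2 = (n : ℝ)⁻¹ * (∑ j, v j) ^ 2 := by
    field_simp
  rw [this]
  have : 0 ≤ (n : ℝ)⁻¹ * (∑ j, v j) ^ 2 := by positivity
  linarith

theorem toEuclideanLin_one_sub_uniformMatrix {v : EuclideanSpace ℝ (Fin n)} (hv : ∑ j, v j = 0) :
    Matrix.toEuclideanLin (1 - uniformMatrix n) v = v := by
  ext i
  simp [Matrix.toLpLin_apply, uniformMatrix, Matrix.mulVec, dotProduct,
      ← Finset.mul_sum, hv]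

/-- The singular values of `1 - uniformMatrix n` are `1`, with multiplicity `n - 1`, and `0`; a
perturbation of norm `η` moves each of the first `n - 1` by at most `η`. -/
theorem abs_singularValue_sub_one_le (A : Matrix (Fin n) (Fin n) ℝ) {j : ℕ} (hj : j + 1 < n) :
    |singularValue (A - 1) j - 1| ≤ ‖A - uniformMatrix n‖ := by
  set η := ‖A - uniformMatrix n‖
  have hdecomp : A - 1 = (A - uniformMatrix n) - (1 - uniformMatrix n) := by abel
  rw [abs_le]
  constructor
  · rcases le_or_gt 1 η with h1 | h1
    · have := (Matrix.toEuclideanLin (A - 1)).singularValues_nonneg j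
      rw [singularValue]
      linarith
    · have := le_singularValue_of_bounded_below (A := A - 1) (c := 1 - η) (by linarith)
        (∑ k, (EuclideanSpace.proj k : EuclideanSpace ℝ (Fin n) →L[ℝ] ℝ).toLinearMap)
        (fun v hv => ?_) hj
      · linarith
      · have hv' : ∑ k, v k = 0 := by simpa using hv
        have h2 := norm_toEuclideanLin_le (A - uniformMatrix n) v
        rw [hdecomp, map_sub, LinearMap.sub_apply, toEuclideanLin_one_sub_uniformMatrix hv',
          norm_sub_rev]
        linarith [norm_sub_norm_le v (Matrix.toEuclideanLin (A - uniformMatrix n) v)]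
  · have h1 : ‖(1 : Matrix (Fin n) (Fin n) ℝ) - uniformMatrix n‖ ≤ 1 := by
      rw [Matrix.cstar_norm_def]
      refine ContinuousLinearMap.opNorm_le_bound _ zero_le_one fun v => ?_
      rw [one_mul]
      exact norm_one_sub_uniformMatrix_apply_le v
    have h2 := singularValue_le (A - 1) j
    have h3 := norm_sub_le (A - uniformMatrix n) (1 - uniformMatrix n)
    rw [← hdecomp] at h3
    linarith

theorem rank_eq_finrank_range_toEuclideanLin (A : Matrix (Fin n) (Fin n) ℝ) :
    A.rank = Module.finrank ℝ (Matrix.toEuclideanLin A).range := by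
  change _ = Module.finrank ℝ (Matrix.toLpLin 2 2 A).range
  rw [Matrix.toLpLin_eq_toLin]
  exact A.rank_eq_finrank_range_toLin _ _

theorem singularValue_last_eq_zero {A : Matrix (Fin n) (Fin n) ℝ} (hn : n ≠ 0)
    (hA : ∀ i, ∑ j, A i j = 1) : singularValue (A - 1) (n - 1) = 0 := by
  rw [singularValue, LinearMap.singularValues_eq_zero_iff_le_finrank_range]
  set f := Matrix.toEuclideanLin (A - 1)
  have h1 : (WithLp.toLp 2 fun _ => 1 : EuclideanSpace ℝ (Fin n)) ∈ f.ker := by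
    rw [LinearMap.mem_ker]
    ext i
    simp [f, Matrix.toLpLin_apply, Matrix.mulVec, dotProduct, hA]
  have h2 : f.ker ≠ ⊥ := by
    intro hbot
    rw [hbot, Submodule.mem_bot] at h1
    have := congrArg (fun v : EuclideanSpace ℝ (Fin n) => v ⟨0, Nat.pos_of_ne_zero hn⟩) h1
    simp at this
  have h3 := Submodule.one_le_finrank_iff.2 h2
  have h4 := f.finrank_range_add_finrank_ker
  rw [finrank_euclideanSpace_fin] at h4
  omega

theorem rank_eq_of_singularValue {A : Matrix (Fin n) (Fin n) ℝ} (hn : 2 ≤ n)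
    (h0 : singularValue A (n - 1) = 0) (h1 : 0 < singularValue A (n - 2)) : A.rank = n - 1 := by
  rw [singularValue, LinearMap.singularValues_eq_zero_iff_le_finrank_range] at h0
  rw [singularValue, LinearMap.singularValues_pos_iff_lt_finrank_range] at h1
  rw [rank_eq_finrank_range_toEuclideanLin]
  omega

theorem transitionMatrix_row_sum (hT : ∀ i, (T i).Nonempty) (hx : ∀ i j, 0 < x i j) (i : Fin n) :
    ∑ j, transitionMatrix T x i j = 1 := by
  simp only [transitionMatrix, Matrix.of_apply, Finset.sum_ite_mem, Finset.univ_inter,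
    ← Finset.sum_div]
  exact div_self (Finset.sum_pos (fun j _ => hx i j) (hT i)).ne'

theorem IsRegularArray.norm_transitionMatrix_sub_uniformMatrix_le {ω : ℝ} (hω : 0 < ω) (hn : n ≠ 0)
    (hT : ∀ i, ω * n ≤ (T i).card) (hK : 1 ≤ K) (hc : 0 < c) (hKc : K ^ 2 ≤ c / 2 * √(ω * n))
    (h : IsRegularArray T K c x) :
    ‖transitionMatrix T x - uniformMatrix n‖ ≤
      18 / (c * ω) * (K ^ 2 / √n) + √((modifiedRows T).card / (ω * n)) := by
  have hn' : (0 : ℝ) < n := by positivity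
  have hcard : ∀ i, (0 : ℝ) < (T i).card := fun i => (mul_pos hω hn').trans_le (hT i)
  have hne : ∀ i, (T i).Nonempty := fun i => Finset.card_pos.1 (by exact_mod_cast hcard i)
  have hS : ∀ i, c / 2 * (ω * n) ≤ ∑ l ∈ T i, x i l := by
    intro i
    refine le_trans (by gcongr; exact hT i) (h.le_sum (fun i => ?_) i)
    have h1 : √(ω * n) ≤ √(T i).card := Real.sqrt_le_sqrt (hT i)
    calc K ^ 2 * √(T i).card ≤ c / 2 * √(T i).card * √(T i).card := by
          gcongr
          exact hKc.trans (by gcongr)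
      _ = c / 2 * (T i).card := by rw [mul_assoc, Real.mul_self_sqrt (hcard i).le]
  have h1 := norm_transitionMatrix_sub_meanMatrix_le hn hne (by positivity) hS
  have h2 := norm_meanMatrix_sub_uniformMatrix_le hω hn hT
  have h3 := h.norm_centredMatrix_le hn hne hK
  have h4 : √n * ((c / 2 * (ω * n))⁻¹ * ‖centredMatrix T x‖) ≤ 18 / (c * ω) * (K ^ 2 / √n) := by
    calc √n * ((c / 2 * (ω * n))⁻¹ * ‖centredMatrix T x‖)
        ≤ √n * ((c / 2 * (ω * n))⁻¹ * (9 * K ^ 2)) := by gcongr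
      _ = √n * ((c / 2 * (ω * (√n * √n)))⁻¹ * (9 * K ^ 2)) := by
          rw [Real.mul_self_sqrt hn'.le]
      _ = _ := by
          have : √(n : ℝ) ≠ 0 := by positivity
          field_simp
          ring
  calc ‖transitionMatrix T x - uniformMatrix n‖
      = ‖(transitionMatrix T x - meanMatrix T) + (meanMatrix T - uniformMatrix n)‖ := by
        rw [sub_add_sub_cancel]
    _ ≤ _ := (norm_add_le _ _).trans (add_le_add (h1.trans h4) h2)

end Deterministic

/-! ### Asymptotics and stochastic domination -/

section Asymptotics

open Filter

theorem eventually_le_natCast_rpow {a : ℝ} (ha : 0 < a) (C : ℝ) :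
    ∀ᶠ n : ℕ in atTop, C ≤ (n : ℝ) ^ a :=
  ((tendsto_rpow_atTop ha).comp tendsto_natCast_atTop_atTop).eventually_ge_atTop C

/-- With `K = n ^ δ`, the probability that the array is not regular decays faster than any power of
`n`. -/
theorem eventually_failure_bound_le {δ : ℝ} (hδ : 0 < δ) (hδ1 : δ ≤ 1) (D : ℝ) :
    ∀ᶠ n : ℕ in atTop, (n : ℝ) ^ 2 * Real.exp (-(n : ℝ) ^ δ) + Real.exp (-n) +
      n * (2 * Real.exp (-(2 * ((n : ℝ) ^ δ) ^ 2))) ≤ (n : ℝ) ^ (-D) := by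
  have h1 := ((tendsto_rpow_mul_exp_neg_mul_atTop_nhds_zero ((2 + D) / δ) 1 one_pos).comp
    ((tendsto_rpow_atTop hδ).comp tendsto_natCast_atTop_atTop)).eventually_le_const
    (show (0 : ℝ) < 1 / 4 by norm_num)
  filter_upwards [h1, eventually_ge_atTop 1] with n hn hn1
  have hn1' : (1 : ℝ) ≤ n := by exact_mod_cast hn1
  have hpos : (0 : ℝ) < n := by linarith
  simp only [Function.comp_apply, ← Real.rpow_mul hpos.le] at hn
  rw [mul_div_cancel₀ _ hδ.ne', Real.rpow_add hpos, Real.rpow_two, neg_mul, one_mul] at hn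
  set y := (n : ℝ) ^ δ
  have hy1 : 1 ≤ y := Real.one_le_rpow hn1' hδ.le
  have hyn : y ≤ n := by simpa using Real.rpow_le_rpow_of_exponent_le hn1' hδ1
  have e1 : Real.exp (-n) ≤ Real.exp (-y) := Real.exp_le_exp.2 (by linarith)
  have e2 : Real.exp (-(2 * y ^ 2)) ≤ Real.exp (-y) := Real.exp_le_exp.2 (by nlinarith)
  have hD : 0 < (n : ℝ) ^ D := Real.rpow_pos_of_pos hpos D
  rw [Real.rpow_neg hpos.le, ← one_div, le_div_iff₀ hD]
  have hE := Real.exp_pos (-y)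
  calc ((n : ℝ) ^ 2 * Real.exp (-y) + Real.exp (-n) + n * (2 * Real.exp (-(2 * y ^ 2)))) *
        (n : ℝ) ^ D
      ≤ ((n : ℝ) ^ 2 * Real.exp (-y) + Real.exp (-y) + n * (2 * Real.exp (-y))) * (n : ℝ) ^ D := by
        gcongr
    _ = (n + 1) ^ 2 * (Real.exp (-y) * (n : ℝ) ^ D) := by ring
    _ ≤ (2 * n) ^ 2 * (Real.exp (-y) * (n : ℝ) ^ D) := by gcongr; linarith
    _ = 4 * ((n : ℝ) ^ 2 * (n : ℝ) ^ D * Real.exp (-y)) := by ring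
    _ ≤ 1 := by linarith

theorem IsIIDExpArray.eventually_measureReal_not_isRegularArray_le {Ω : Type*} [MeasurableSpace Ω]
    {P : Measure Ω} [IsProbabilityMeasure P] {x : (n : ℕ) → Fin n → Fin n → Ω → ℝ}
    (hx : IsIIDExpArray P x) {T : (n : ℕ) → Fin n → Finset (Fin n)}
    (hT : ∀ n i, (T n i).Nonempty) {δ : ℝ} (hδ : 0 < δ) (hδ1 : δ ≤ 1) (D : ℝ) :
    ∀ᶠ n : ℕ in atTop, P.real {s | ¬ IsRegularArray (T n) ((n : ℝ) ^ δ)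
      (truncatedMean ((n : ℝ) ^ δ)) (fun i j => x n i j s)} ≤ (n : ℝ) ^ (-D) := by
  filter_upwards [eventually_failure_bound_le hδ hδ1 D, eventually_ge_atTop 1] with n hn hn1
  have hpos : (0 : ℝ) < n := by exact_mod_cast hn1
  exact (hx.measureReal_not_isRegularArray_le (hT n)
    (Real.rpow_pos_of_pos hpos δ)).trans hn

theorem eventually_norm_transitionMatrix_sub_uniformMatrix_le {ω : ℝ} (hω : 0 < ω)
    {T : (n : ℕ) → Fin n → Finset (Fin n)} (hT : ∀ (n : ℕ) i, ω * (n : ℝ) ≤ ((T n i).card : ℝ))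
    (hr : ∀ᶠ n : ℕ in atTop, ((modifiedRows (T n)).card : ℝ) ≤ (n : ℝ) ^ (1 / 2 : ℝ))
    {ε : ℝ} (hε : 0 < ε) :
    ∀ᶠ n : ℕ in atTop, ∀ x : Fin n → Fin n → ℝ,
      IsRegularArray (T n) ((n : ℝ) ^ (1 / 8 : ℝ)) (truncatedMean ((n : ℝ) ^ (1 / 8 : ℝ))) x →
      ‖transitionMatrix (T n) x - uniformMatrix n‖ ≤ (n : ℝ) ^ ε * (n : ℝ) ^ (-(1 / 4) : ℝ) := by
  filter_upwards [hr, eventually_ge_atTop 1,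
    eventually_le_natCast_rpow (a := 1 / 4) (by norm_num) (2 * Real.exp 1 / √ω),
    eventually_le_natCast_rpow hε (18 / (Real.exp (-1) * ω) + (√ω)⁻¹)] with n hr hn1 hn2 hn3 x hx
  have hn1' : (1 : ℝ) ≤ n := by exact_mod_cast hn1
  have hpos : (0 : ℝ) < n := by linarith
  have hK1 : 1 ≤ (n : ℝ) ^ (1 / 8 : ℝ) := Real.one_le_rpow hn1' (by norm_num)
  have hc := exp_neg_one_le_truncatedMean hK1
  set K := (n : ℝ) ^ (1 / 8 : ℝ)
  set c := truncatedMean K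
  -- All quantities are powers of `q = n ^ (1 / 4)`: `K ^ 2 = q`, `√n = q ^ 2`.
  set q := (n : ℝ) ^ (1 / 4 : ℝ)
  have hqpos : 0 < q := Real.rpow_pos_of_pos hpos _
  have hKq : K ^ 2 = q := by
    rw [← Real.rpow_natCast, ← Real.rpow_mul hpos.le]; norm_num [q]
  have hqn : √(n : ℝ) = q ^ 2 := by
    rw [Real.sqrt_eq_rpow, ← Real.rpow_natCast, ← Real.rpow_mul hpos.le]; norm_num
  have hqh : (n : ℝ) ^ (1 / 2 : ℝ) = q ^ 2 := by rw [← hqn, Real.sqrt_eq_rpow]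
  have hnq : (n : ℝ) = q ^ 4 := by
    rw [← Real.sq_sqrt hpos.le, hqn]; ring
  have hqinv : (n : ℝ) ^ (-(1 / 4) : ℝ) = q⁻¹ := Real.rpow_neg hpos.le _
  have hc0 : 0 < c := (Real.exp_pos _).trans_le hc
  have hω' : 0 < √ω := Real.sqrt_pos.2 hω
  have hKc : K ^ 2 ≤ c / 2 * √(ω * n) := by
    rw [hKq, Real.sqrt_mul hω.le, hqn]
    rw [div_le_iff₀ hω'] at hn2
    have h1 : Real.exp (-1) * Real.exp 1 = 1 := by rw [← Real.exp_add]; simp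
    have h2 : 1 ≤ c / 2 * (q * √ω) := by
      calc 1 = Real.exp (-1) / 2 * (2 * Real.exp 1) := by linear_combination -h1
        _ ≤ c / 2 * (q * √ω) := by gcongr
    calc q = q * 1 := by ring
      _ ≤ q * (c / 2 * (q * √ω)) := by gcongr
      _ = c / 2 * (√ω * q ^ 2) := by ring
  refine (hx.norm_transitionMatrix_sub_uniformMatrix_le hω (by omega) (hT n) hK1 hc0 hKc).trans ?_
  have h1 : 18 / (c * ω) * (K ^ 2 / √n) ≤ 18 / (Real.exp (-1) * ω) * q⁻¹ := by
    have : K ^ 2 / √(n : ℝ) = q⁻¹ := by rw [hKq, hqn]; field_simp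
    rw [this]
    gcongr
  have h2 : √((modifiedRows (T n)).card / (ω * n)) ≤ (√ω)⁻¹ * q⁻¹ := by
    refine Real.sqrt_le_iff.2 ⟨by positivity, ?_⟩
    rw [mul_pow, inv_pow, Real.sq_sqrt hω.le, div_le_iff₀ (by positivity), hnq]
    refine (hr.trans_eq hqh).trans_eq ?_
    field_simp
  rw [hqinv]
  calc _ ≤ 18 / (Real.exp (-1) * ω) * q⁻¹ + (√ω)⁻¹ * q⁻¹ := add_le_add h1 h2
    _ = (18 / (Real.exp (-1) * ω) + (√ω)⁻¹) * q⁻¹ := by ring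
    _ ≤ _ := by gcongr

theorem IsIIDExpArray.stochDom_gramEigenvalue {Ω : Type*} [MeasurableSpace Ω]
    {P : Measure Ω} [IsProbabilityMeasure P] {x : (n : ℕ) → Fin n → Fin n → Ω → ℝ}
    (hx : IsIIDExpArray P x) {T : (n : ℕ) → Fin n → Finset (Fin n)}
    (hT : ∀ n i, (T n i).Nonempty) :
    StochDom P (V := fun n => Fin n)
      (fun n k s => gramEigenvalue (centredMatrix (T n) (fun i j => x n i j s)) k)
      (fun _ _ _ => 1) := by
  intro ε hε D _
  have hδ : 0 < min (ε / 8) 1 := lt_min (by linarith) one_pos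
  obtain ⟨N₀, hN₀⟩ := eventually_atTop.1
    ((hx.eventually_measureReal_not_isRegularArray_le hT hδ (min_le_right _ _) D).and
      (eventually_le_natCast_rpow (half_pos hε) 81))
  refine ⟨N₀, fun n hn v => ?_⟩
  obtain ⟨h1, h2⟩ := hN₀ n hn.le
  refine (measureReal_mono (fun s hs hreg => ?_) (measure_ne_top P _)).trans h1
  have hn0 : n ≠ 0 := by omega
  have hn1 : (1 : ℝ) ≤ n := by exact_mod_cast Nat.pos_of_ne_zero hn0
  have hpos : (0 : ℝ) < n := by linarith
  refine not_lt.2 ?_ (Set.mem_ofPred.1 hs)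
  set K := (n : ℝ) ^ min (ε / 8) 1 with hK
  have hK1 : 1 ≤ K := Real.one_le_rpow hn1 hδ.le
  have hK4 : K ^ 4 ≤ (n : ℝ) ^ (ε / 2) := by
    rw [hK, ← Real.rpow_natCast, ← Real.rpow_mul hpos.le]
    refine Real.rpow_le_rpow_of_exponent_le hn1 ?_
    have := min_le_left (ε / 8) 1
    push_cast
    linarith
  refine (gramEigenvalue_le _ v).trans ?_
  calc _ ≤ (9 * K ^ 2) ^ 2 :=
        pow_le_pow_left₀ (norm_nonneg _) (hreg.norm_centredMatrix_le hn0 (hT n) hK1) 2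
    _ = 81 * K ^ 4 := by ring
    _ ≤ (n : ℝ) ^ (ε / 2) * (n : ℝ) ^ (ε / 2) := by gcongr
    _ = (n : ℝ) ^ ε * 1 := by rw [← Real.rpow_add hpos, add_halves, mul_one]

section SingularValues

variable {Ω : Type*} [MeasurableSpace Ω] {P : Measure Ω} [IsProbabilityMeasure P]
  {x : (n : ℕ) → Fin n → Fin n → Ω → ℝ} {T : (n : ℕ) → Fin n → Finset (Fin n)}

theorem IsIIDExpArray.ae_singularValue_last_eq_zero (hx : IsIIDExpArray P x)
    (hT : ∀ n i, (T n i).Nonempty) {n : ℕ} (hn : n ≠ 0) :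
    ∀ᵐ s ∂P, singularValue (transitionMatrix (T n) (fun i j => x n i j s) - 1) (n - 1) = 0 := by
  filter_upwards [hx.ae_pos n] with s hs
  exact singularValue_last_eq_zero hn (transitionMatrix_row_sum (hT n) hs)

theorem IsIIDExpArray.stochDom_abs_singularValue_sub_one (hx : IsIIDExpArray P x) {ω : ℝ}
    (hω : 0 < ω) (hT : ∀ (n : ℕ) i, ω * (n : ℝ) ≤ ((T n i).card : ℝ))
    (hne : ∀ n i, (T n i).Nonempty)
    (hr : ∀ᶠ n : ℕ in atTop, ((modifiedRows (T n)).card : ℝ) ≤ (n : ℝ) ^ (1 / 2 : ℝ)) :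
    StochDom P (V := fun n => Fin (n - 1))
      (fun n j s =>
        |singularValue (transitionMatrix (T n) (fun i j => x n i j s) - 1) (j : ℕ) - 1|)
      (fun n _ _ => (n : ℝ) ^ (-(1 / 4) : ℝ)) := by
  intro ε hε D _
  obtain ⟨N₀, hN₀⟩ := eventually_atTop.1
    ((hx.eventually_measureReal_not_isRegularArray_le hne (δ := 1 / 8) (by norm_num) (by norm_num)
      D).and (eventually_norm_transitionMatrix_sub_uniformMatrix_le hω hT hr hε))
  refine ⟨N₀, fun n hn v => ?_⟩
  obtain ⟨h1, h2⟩ := hN₀ n hn.le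
  refine (measureReal_mono (fun s hs hreg => ?_) (measure_ne_top P _)).trans h1
  refine not_lt.2 ?_ (Set.mem_ofPred.1 hs)
  exact (abs_singularValue_sub_one_le _ (by omega)).trans (h2 _ hreg)

theorem IsIIDExpArray.withHighProb_rank_eq (hx : IsIIDExpArray P x) {ω : ℝ}
    (hω : 0 < ω) (hT : ∀ (n : ℕ) i, ω * (n : ℝ) ≤ ((T n i).card : ℝ))
    (hne : ∀ n i, (T n i).Nonempty)
    (hr : ∀ᶠ n : ℕ in atTop, ((modifiedRows (T n)).card : ℝ) ≤ (n : ℝ) ^ (1 / 2 : ℝ)) :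
    WithHighProb P (fun n =>
      {s | (transitionMatrix (T n) (fun i j => x n i j s) - 1).rank = n - 1}) := by
  intro D _
  obtain ⟨N₀, hN₀⟩ := eventually_atTop.1
    (((hx.eventually_measureReal_not_isRegularArray_le hne (δ := 1 / 8) (by norm_num) (by norm_num)
      D).and (eventually_norm_transitionMatrix_sub_uniformMatrix_le hω hT hr
        (ε := 1 / 8) (by norm_num))).and (eventually_ge_atTop 2))
  refine ⟨N₀, fun n hn => ?_⟩
  obtain ⟨⟨h1, h2⟩, hn2⟩ := hN₀ n hn
  set E : Set Ω := {s | (transitionMatrix (T n) (fun i j => x n i j s) - 1).rank = n - 1}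
  have hnull : P.real {s | ¬ singularValue
      (transitionMatrix (T n) (fun i j => x n i j s) - 1) (n - 1) = 0} = 0 := by
    rw [measureReal_eq_zero_iff]
    exact ae_iff.1 (hx.ae_singularValue_last_eq_zero hne (by omega))
  have hcover : Set.univ ⊆ E ∪ ({s | ¬ singularValue
      (transitionMatrix (T n) (fun i j => x n i j s) - 1) (n - 1) = 0} ∪
      {s | ¬ IsRegularArray (T n) ((n : ℝ) ^ (1 / 8 : ℝ))
        (truncatedMean ((n : ℝ) ^ (1 / 8 : ℝ))) (fun i j => x n i j s)}) := by
    intro s _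
    by_contra hcon
    simp only [Set.mem_union, Set.mem_ofPred_eq, not_or, not_not, E] at hcon
    obtain ⟨hE, h0, hreg⟩ := hcon
    refine hE (rank_eq_of_singularValue hn2 h0 ?_)
    have h3 := (abs_singularValue_sub_one_le _ (j := n - 2) (by omega)).trans (h2 _ hreg)
    have h4 : (n : ℝ) ^ (1 / 8 : ℝ) * (n : ℝ) ^ (-(1 / 4) : ℝ) < 1 := by
      have hn1 : (1 : ℝ) < n := by exact_mod_cast hn2
      rw [← Real.rpow_add (by linarith)]
      exact Real.rpow_lt_one_of_one_lt_of_neg hn1 (by norm_num)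
    linarith [(abs_le.1 h3).1]
  have h5 : P.real Set.univ ≤ _ := measureReal_mono hcover (measure_ne_top P _)
  have h6 := (h5.trans (measureReal_union_le _ _)).trans
    (add_le_add_right (measureReal_union_le _ _) _)
  rw [probReal_univ, hnull] at h6
  linarith

end SingularValues

theorem eventually_card_modifiedRows_le {T : (n : ℕ) → Fin n → Finset (Fin n)}
    (h : (∃ r : ℕ, ∀ n : ℕ, (modifiedRows (T n)).card ≤ r) ∨
      (∃ ε : ℝ, 0 < ε ∧ ε ≤ 1 / 2 ∧ ∀ n : ℕ, ((modifiedRows (T n)).card : ℝ) ≤ (n : ℝ) ^ ε)) :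
    ∀ᶠ n : ℕ in atTop, ((modifiedRows (T n)).card : ℝ) ≤ (n : ℝ) ^ (1 / 2 : ℝ) := by
  rcases h with ⟨r, hr⟩ | ⟨ε, -, hε, hr⟩
  · filter_upwards [eventually_le_natCast_rpow (a := 1 / 2) (by norm_num) r] with n hn
    exact le_trans (by exact_mod_cast hr n) hn
  · filter_upwards [eventually_ge_atTop 1] with n hn
    exact (hr n).trans (Real.rpow_le_rpow_of_exponent_le (by exact_mod_cast hn) hε)

end Asymptotics

end

theorem mainTheorem3 :
    ∃ ε₀ : ℝ, 0 < ε₀ ∧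
      ∀ ω : ℝ, 0 < ω → ω ≤ 1 →
      ∃ C : ℝ, 0 < C ∧
      ∀ (Ω : Type*) [MeasurableSpace Ω] (P : Measure Ω) [IsProbabilityMeasure P]
        (x : (n : ℕ) → Fin n → Fin n → Ω → ℝ), IsIIDExpArray P x →
      ∀ T : (n : ℕ) → Fin n → Finset (Fin n),
        -- every row keeps at least a fraction `ω` of free entries
        (∀ (n : ℕ) (i : Fin n), ω * (n : ℝ) ≤ ((T n i).card : ℝ)) →
        -- finitely many modified rows (in particular one), or at most `n ^ ε` of them, `ε` small
        ((∃ r : ℕ, ∀ n : ℕ, (modifiedRows (T n)).card ≤ r) ∨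
          (∃ ε : ℝ, 0 < ε ∧ ε ≤ ε₀ ∧ ∀ n : ℕ, ((modifiedRows (T n)).card : ℝ) ≤ (n : ℝ) ^ ε)) →
        StochDom P (V := fun n => Fin n)
            (fun n k s => gramEigenvalue (centredMatrix (T n) (fun i j => x n i j s)) k)
            (fun _ _ _ => C) ∧
        (∀ n : ℕ, 1 ≤ n → ∀ᵐ s ∂P,
          singularValue (transitionMatrix (T n) (fun i j => x n i j s) - 1) (n - 1) = 0) ∧
        StochDom P (V := fun n => Fin (n - 1))
            (fun n j s =>
              |singularValue (transitionMatrix (T n) (fun i j => x n i j s) - 1) (j : ℕ) - 1|)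
            (fun n _ _ => (n : ℝ) ^ (-(1 / 4) : ℝ)) ∧
        WithHighProb P (fun n =>
          {s | (transitionMatrix (T n) (fun i j => x n i j s) - 1).rank = n - 1}) := by
  refine ⟨1 / 2, by norm_num, fun ω hω _ => ⟨1, one_pos, fun Ω _ P _ x hx T hT hmod => ?_⟩⟩
  have hne : ∀ n i, (T n i).Nonempty := by
    intro n i
    have hn : (0 : ℝ) < n := by exact_mod_cast i.pos
    have := (mul_pos hω hn).trans_le (hT n i)
    exact Finset.card_pos.1 (by exact_mod_cast this)
  have hr := eventually_card_modifiedRows_le hmod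
  exact ⟨hx.stochDom_gramEigenvalue hne,
    fun n hn => hx.ae_singularValue_last_eq_zero hne (by omega),
    hx.stochDom_abs_singularValue_sub_one hω hT hne hr,
    hx.withHighProb_rank_eq hω hT hne hr⟩
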